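/- Let $A=\mathbb{C}[x,y]$, let $a\in A\setminus\{0\}$, and write $a_x=\partial a/\partial x$, $a_y=\partial a/\partial y$. Let $\delta$ be the $\mathbb{C}$-derivation of $A$ such that $\delta(x)=a_y$ and $\delta(y)=-a_x$, and let $R=A[z;\delta]$ be the Ore extension: its elements are uniquely of the form $\sum_{i=0}^n a_iz^i$ with $a_i\in A$, and $zb-bz=\delta(b)$ for all $b\in A$. Let $J=a_yA+a_xA$. A prime ideal of a ring is a proper two-sided ideal $P$ such that, for all two-sided ideals $I,I'$, $II'\subseteq P$ implies $I\subseteq P$ or $I'\subseteq P$. Then: (i) The right ideal $JR$ is a two-sided ideal of $R$, and there is an isomorphism of $\mathbb{C}$-algebras $R/JR\to (A/J)[z]$ (commutative polynomial ring) given by $\sum_i a_iz^i+JR\mapsto\sum_i (a_i+J)z^i$. (ii) The prime ideals of $R$ are precisely the following: $0$; the ideals $uR$, where $u$ is an irreducible factor in $A$ of $a-\lambda$ for some $\lambda\in\mathbb{C}$ such that $a-\lambda$ is a non-zero non-unit of $A$; and the ideals $\pi^{-1}(Q)$, where $Q$ is a prime ideal of $(A/J)[z]$ and $\pi$ is the composition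 $R\twoheadrightarrow R/JR\cong (A/J)[z]$. Moreover, each such right ideal $uR$ is a two-sided ideal, and is a prime ideal of $R$ of height one (the height of a prime is the supremum of the lengths of chains of primes descending from it). -/

import Mathlib

open Polynomial

noncomputable section

/-! ### The Ore extension `A[z; δ]` -/

/-- The Ore extension (ring of formal differential operators) `A[z; δ]` of a commutative
`k`-algebra `A` by a `k`-derivation `δ`.  Its elements are the formal sums `∑ aᵢ zⁱ` with the
coefficients `aᵢ ∈ A` written on the left, stored as the coefficient sequence of a polynomial;
the multiplication defined below is determined by `z a = a z + δ a`. -/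
def OreExtension {k A : Type*} [CommRing k] [CommRing A] [Algebra k A]
    (_δ : Derivation k A A) : Type _ := A[X]

namespace OreExtension

variable {k A : Type*} [CommRing k] [CommRing A] [Algebra k A] (δ : Derivation k A A)

instance : AddCommGroup (OreExtension δ) := inferInstanceAs (AddCommGroup A[X])

instance : Module k (OreExtension δ) := inferInstanceAs (Module k A[X])

/-- The formal sum `∑ aᵢ zⁱ` with the coefficients of a given polynomial. -/
def ofPoly : A[X] ≃ₗ[k] OreExtension δ := LinearEquiv.refl k A[X]

/-- Left multiplication by `z`: the sum `∑ bⱼ zʲ` is sent to `∑ (bⱼ zʲ⁺¹ + δ(bⱼ) zʲ)`. -/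
def zMul : Module.End k A[X] where
  toFun q := q.sum fun j b => monomial (j + 1) b + monomial j (δ b)
  map_add' p q := sum_add_index _ _ _ (by simp) (by intros; simp only [map_add]; abel)
  map_smul' r q := by
    rw [sum_smul_index' _ _ _ (by simp), RingHom.id_apply, Polynomial.smul_sum]
    simp only [Derivation.map_smul, smul_add, smul_monomial]

/-- The product `(∑ aᵢ zⁱ) q = ∑ aᵢ (zⁱ q)`. -/
def mulAux : A[X] →ₗ[k] Module.End k A[X] where
  toFun p := p.sum fun i a => a • (zMul δ) ^ i
  map_add' p q := sum_add_index _ _ _ (by simp) (by intros; rw [add_smul])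
  map_smul' r p := by
    rw [sum_smul_index' _ _ _ (by simp), RingHom.id_apply, Polynomial.smul_sum]
    simp only [smul_assoc]

@[simp] lemma zMul_monomial (j : ℕ) (b : A) :
    zMul δ (monomial j b) = monomial (j + 1) b + monomial j (δ b) := by
  simp [zMul]

@[simp] lemma mulAux_monomial (i : ℕ) (a : A) :
    mulAux δ (monomial i a) = a • (zMul δ) ^ i := by
  simp [mulAux]

lemma zMul_smul (a : A) (q : A[X]) : zMul δ (a • q) = a • zMul δ q + δ a • q := by
  induction q using Polynomial.induction_on' with
  | add p q hp hq => simp only [smul_add, map_add, hp, hq]; abel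
  | monomial n b =>
    simp only [smul_monomial, zMul_monomial, smul_eq_mul, Derivation.leibniz, map_add, smul_add]
    rw [mul_comm b (δ a)]
    abel

lemma mulAux_smul (a : A) (q : A[X]) : mulAux δ (a • q) = a • mulAux δ q := by
  induction q using Polynomial.induction_on' with
  | add p q hp hq => simp only [smul_add, map_add, hp, hq]
  | monomial n b => simp only [smul_monomial, mulAux_monomial, smul_eq_mul, mul_smul]

lemma mulAux_zMul (q : A[X]) : mulAux δ (zMul δ q) = zMul δ * mulAux δ q := by
  induction q using Polynomial.induction_on' with
  | add p q hp hq => simp only [map_add, hp, hq, mul_add]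
  | monomial n b =>
    ext1 r
    simp only [zMul_monomial, map_add, mulAux_monomial, LinearMap.add_apply,
      LinearMap.smul_apply, Module.End.mul_apply, zMul_smul, pow_succ']

lemma mulAux_mulAux (p q : A[X]) : mulAux δ (mulAux δ p q) = mulAux δ p * mulAux δ q := by
  induction p using Polynomial.induction_on' with
  | add p p' hp hp' => simp only [map_add, LinearMap.add_apply, hp, hp', add_mul]
  | monomial n b =>
    have key : ∀ m : ℕ, mulAux δ ((zMul δ ^ m) q) = zMul δ ^ m * mulAux δ q := by
      intro m
      induction m with
      | zero => simp
      | succ m ih => rw [pow_succ', Module.End.mul_apply, mulAux_zMul, ih, mul_assoc]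
    rw [mulAux_monomial, LinearMap.smul_apply, mulAux_smul, key, smul_mul_assoc]

lemma mulAux_one_right (p : A[X]) : mulAux δ p 1 = p := by
  have key : ∀ m : ℕ, (zMul δ ^ m) (1 : A[X]) = monomial m 1 := by
    intro m
    induction m with
    | zero => simp
    | succ m ih => rw [pow_succ', Module.End.mul_apply, ih]; simp
  induction p using Polynomial.induction_on' with
  | add p q hp hq => simp only [map_add, LinearMap.add_apply, hp, hq]
  | monomial n b => simp [key, smul_monomial]

instance : Mul (OreExtension δ) :=
  ⟨fun p q => ofPoly δ (mulAux δ ((ofPoly δ).symm p) ((ofPoly δ).symm q))⟩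

instance : One (OreExtension δ) := ⟨ofPoly δ 1⟩

lemma ofPoly_mul_ofPoly (p q : A[X]) :
    ofPoly δ p * ofPoly δ q = ofPoly δ (mulAux δ p q) := rfl

lemma one_def : (1 : OreExtension δ) = ofPoly δ 1 := rfl

instance : Ring (OreExtension δ) :=
  { (inferInstance : AddCommGroup (OreExtension δ)),
    (inferInstance : Mul (OreExtension δ)),
    (inferInstance : One (OreExtension δ)) with
    left_distrib := fun p q r => by
      obtain ⟨p, rfl⟩ := (ofPoly δ).surjective p
      obtain ⟨q, rfl⟩ := (ofPoly δ).surjective q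
      obtain ⟨r, rfl⟩ := (ofPoly δ).surjective r
      simp only [← map_add, ofPoly_mul_ofPoly]
    right_distrib := fun p q r => by
      obtain ⟨p, rfl⟩ := (ofPoly δ).surjective p
      obtain ⟨q, rfl⟩ := (ofPoly δ).surjective q
      obtain ⟨r, rfl⟩ := (ofPoly δ).surjective r
      simp only [← map_add, ofPoly_mul_ofPoly]
      rw [map_add (mulAux δ), LinearMap.add_apply]
    zero_mul := fun p => by
      obtain ⟨p, rfl⟩ := (ofPoly δ).surjective p
      rw [← map_zero (ofPoly δ), ofPoly_mul_ofPoly, map_zero, LinearMap.zero_apply]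
    mul_zero := fun p => by
      obtain ⟨p, rfl⟩ := (ofPoly δ).surjective p
      rw [← map_zero (ofPoly δ), ofPoly_mul_ofPoly, map_zero]
    mul_assoc := fun p q r => by
      obtain ⟨p, rfl⟩ := (ofPoly δ).surjective p
      obtain ⟨q, rfl⟩ := (ofPoly δ).surjective q
      obtain ⟨r, rfl⟩ := (ofPoly δ).surjective r
      simp only [ofPoly_mul_ofPoly, mulAux_mulAux, Module.End.mul_apply]
    one_mul := fun p => by
      obtain ⟨p, rfl⟩ := (ofPoly δ).surjective p
      rw [one_def, ofPoly_mul_ofPoly, ← monomial_zero_one, mulAux_monomial, pow_zero, one_smul,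
        Module.End.one_apply]
    mul_one := fun p => by
      obtain ⟨p, rfl⟩ := (ofPoly δ).surjective p
      rw [one_def, ofPoly_mul_ofPoly, mulAux_one_right] }

instance : Algebra k (OreExtension δ) := Algebra.ofModule
  (fun r p q => by
    obtain ⟨p, rfl⟩ := (ofPoly δ).surjective p
    obtain ⟨q, rfl⟩ := (ofPoly δ).surjective q
    rw [← map_smul, ofPoly_mul_ofPoly, map_smul (mulAux δ), LinearMap.smul_apply, map_smul,
      ofPoly_mul_ofPoly])
  (fun r p q => by
    obtain ⟨p, rfl⟩ := (ofPoly δ).surjective p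
    obtain ⟨q, rfl⟩ := (ofPoly δ).surjective q
    rw [← map_smul, ofPoly_mul_ofPoly, map_smul, map_smul, ofPoly_mul_ofPoly])

/-- The inclusion of the coefficient algebra `A` in `A[z; δ]`. -/
def ι : A →ₐ[k] OreExtension δ :=
  AlgHom.ofLinearMap
    { toFun := fun a => ofPoly δ (monomial 0 a)
      map_add' := fun a b => by simp only [map_add]
      map_smul' := fun r a => by rw [← smul_monomial, map_smul, RingHom.id_apply] }
    (by rw [LinearMap.coe_mk, AddHom.coe_mk, monomial_zero_one, one_def])
    (fun a b => by
      simp only [LinearMap.coe_mk, AddHom.coe_mk, ofPoly_mul_ofPoly, mulAux_monomial, pow_zero,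
        LinearMap.smul_apply, Module.End.one_apply, smul_monomial, smul_eq_mul])

/-- The indeterminate `z` of `A[z; δ]`. -/
def z : OreExtension δ := ofPoly δ (monomial 1 1)

/-- The defining relation `z a - a z = δ a`. -/
lemma z_mul_ι (a : A) : z δ * ι δ a = ι δ a * z δ + ι δ (δ a) := by
  have h : ∀ a, ι δ a = ofPoly δ (monomial 0 a) := fun _ => rfl
  simp only [h, z, ofPoly_mul_ofPoly, ← map_add, mulAux_monomial, pow_zero, pow_one, one_smul,
    zMul_monomial, LinearMap.smul_apply, Module.End.one_apply, smul_monomial, smul_eq_mul,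
    mul_one, zero_add]

/-- `a zⁱ` is the formal sum with the single coefficient `a` in degree `i`. -/
lemma ι_mul_z_pow (a : A) (i : ℕ) : ι δ a * z δ ^ i = ofPoly δ (monomial i a) := by
  have hz : z δ ^ i = ofPoly δ (monomial i 1) := by
    induction i with
    | zero => rw [pow_zero, monomial_zero_one, one_def]
    | succ i ih => rw [pow_succ', ih, z, ofPoly_mul_ofPoly]; simp
  rw [hz]
  change ofPoly δ (monomial 0 a) * _ = _
  rw [ofPoly_mul_ofPoly, mulAux_monomial]
  simp [smul_monomial]

/-- `ofPoly δ p` is the sum `∑ aᵢ zⁱ` in the ring `A[z; δ]`, where the `aᵢ` are the coefficients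
of `p`. Hence `A[z; δ]` is a free left `A`-module on the powers of `z`. -/
lemma ofPoly_eq_sum (p : A[X]) : ofPoly δ p = p.sum fun i a => ι δ a * z δ ^ i := by
  conv_lhs => rw [← sum_monomial_eq p]
  simp only [sum_def, map_sum, ι_mul_z_pow]

end OreExtension

/-! ### Ideals and prime ideals of noncommutative rings -/

/-- A prime ideal of a (not necessarily commutative) ring: a proper two-sided ideal `P` such that,
for all two-sided ideals `I`, `J`, if `I J ⊆ P` then `I ⊆ P` or `J ⊆ P`. -/
def TwoSidedIdeal.IsPrimeIdeal {R : Type*} [Ring R] (P : TwoSidedIdeal R) : Prop :=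
  P ≠ ⊤ ∧ ∀ I J : TwoSidedIdeal R, (∀ x ∈ I, ∀ y ∈ J, x * y ∈ P) → I ≤ P ∨ J ≤ P

/-- The right ideal `S R` generated by a subset `S` of a ring `R`. -/
abbrev rightIdealSpan {R : Type*} [Ring R] (S : Set R) : Submodule Rᵐᵒᵖ R :=
  Submodule.span Rᵐᵒᵖ S

/-- The height of a prime ideal: the supremum of the lengths of the chains of prime ideals
below it. -/
def TwoSidedIdeal.IsPrimeIdeal.height {R : Type*} [Ring R] {P : TwoSidedIdeal R}
    (hP : P.IsPrimeIdeal) : ℕ∞ :=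
  Order.height (⟨P, hP⟩ : {Q : TwoSidedIdeal R // Q.IsPrimeIdeal})

/-! ### Polynomials in two variables -/

/-- The polynomial algebra `ℂ[x, y]`, with `x = X 0` and `y = X 1`. -/
abbrev PolyXY : Type := MvPolynomial (Fin 2) ℂ

/-- The ideal `J = a_y A + a_x A` of `A = ℂ[x, y]`. -/
def gradIdeal (a : PolyXY) : Ideal PolyXY :=
  Ideal.span {MvPolynomial.pderiv 1 a, MvPolynomial.pderiv 0 a}

/-- `u` is an irreducible factor of `a - c`, for some `c ∈ ℂ` such that `a - c` is a non-zero
non-unit. -/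
def IsFiberFactor (a u : PolyXY) : Prop :=
  ∃ c : ℂ, a - MvPolynomial.C c ≠ 0 ∧ ¬ IsUnit (a - MvPolynomial.C c) ∧
    Irreducible u ∧ u ∣ a - MvPolynomial.C c

end

/-! Contract a prime `P` of `R` to `p = P ∩ A`. Since `δ b = z b - b z`, `p` is `δ`-stable;
primeness of `P` makes `p` prime against stable ideals, and in a Noetherian algebra of
characteristic zero this forces `p` to be prime (`isPrime_of_forall_differential`). There are two
cases. If `δ(A) ⊆ p`, then `J ⊆ p`, so `P` contains `JR` and comes from the commutative ring `R/JR =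
(A/J)[z]`. If `δ b ∉ p` for some `b`, commuting with `b` lowers the degree in `z`, which gives `P =
pR` (`eq_coeffIdeal_contraction`). Suppose `p ≠ 0`. As `δ a = 0` and `δ` is nonzero on `A/p`,
transcendence degree forces `a` to be algebraic, hence a scalar `c`, modulo `p`. So `p` contains an
irreducible factor `u` of `a - c`; were `(u)` smaller than `p`, `A/p` would be algebraic over `ℂ`
and `δ` would vanish on it. Hence `P = uR`. Conversely `δ a = 0` makes `(u)` stable, and comparing
leading coefficients modulo `u` shows that `uR` is prime. -/

namespace OreExtension

/-! ### Two-sided ideals of `A[z; δ]` extended from stable ideals of `A` -/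

section CoeffIdeal

variable {k A : Type*} [CommRing k] [CommRing A] [Algebra k A] (δ : Derivation k A A)

lemma coeff_zMul_succ (q : A[X]) (n : ℕ) :
    (zMul δ q).coeff (n + 1) = q.coeff n + δ (q.coeff (n + 1)) := by
  induction q using Polynomial.induction_on' with
  | add p q hp hq => simp only [map_add, coeff_add, hp, hq]; abel
  | monomial m b =>
    simp only [zMul_monomial, coeff_add, coeff_monomial, add_left_inj]
    split_ifs <;> simp

lemma coeff_zMul_zero (q : A[X]) : (zMul δ q).coeff 0 = δ (q.coeff 0) := by
  induction q using Polynomial.induction_on' with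
  | add p q hp hq => simp only [map_add, coeff_add, hp, hq]
  | monomial m b =>
    simp only [zMul_monomial, coeff_add, coeff_monomial]
    split_ifs <;> simp_all

lemma mulAux_apply (p q : A[X]) : mulAux δ p q = p.sum fun i a => a • (zMul δ ^ i) q := by
  change (p.sum fun i a => a • (zMul δ) ^ i) q = _
  simp [Polynomial.sum_def, LinearMap.sum_apply]

lemma coeff_mulAux (p q : A[X]) (n : ℕ) :
    (mulAux δ p q).coeff n = ∑ i ∈ p.support, p.coeff i * ((zMul δ ^ i) q).coeff n := by
  simp [mulAux_apply, Polynomial.sum_def]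

variable {δ}

lemma coeff_zMul_pow_mem {I : Ideal A} (hI : ∀ b ∈ I, δ b ∈ I) {q : A[X]}
    (hq : ∀ n, q.coeff n ∈ I) (i n : ℕ) : ((zMul δ ^ i) q).coeff n ∈ I := by
  induction i generalizing n with
  | zero => simpa using hq n
  | succ i ih =>
    rw [pow_succ', Module.End.mul_apply]
    cases n with
    | zero => rw [coeff_zMul_zero]; exact hI _ (ih 0)
    | succ n => rw [coeff_zMul_succ]; exact I.add_mem (ih n) (hI _ (ih _))

/-- Only the right factor is differentiated when powers of `z` move past it, so only `I'` has to be
stable. Taking one ideal to be `⊤` gives two-sidedness of `coeffIdeal`. -/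
lemma coeff_mulAux_mem {I I' : Ideal A} (hI' : ∀ b ∈ I', δ b ∈ I') {p q : A[X]}
    (hp : ∀ n, p.coeff n ∈ I) (hq : ∀ n, q.coeff n ∈ I') (n : ℕ) :
    (mulAux δ p q).coeff n ∈ I * I' := by
  rw [coeff_mulAux]
  exact Ideal.sum_mem _ fun i _ => Ideal.mul_mem_mul (hp i) (coeff_zMul_pow_mem hI' hq i n)

variable (δ) in
/-- The formal sums with all coefficients in a `δ`-stable ideal form a two-sided ideal. -/
noncomputable def coeffIdeal (I : Ideal A) (hI : ∀ b ∈ I, δ b ∈ I) : TwoSidedIdeal (OreExtension δ) :=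
  .mk' {r | ∀ n, ((ofPoly δ).symm r).coeff n ∈ I}
    (fun n => by simp)
    (fun {r s} hr hs n => by
      rw [map_add, coeff_add]; exact I.add_mem (hr n) (hs n))
    (fun {r} hr n => by rw [map_neg, coeff_neg]; exact I.neg_mem (hr n))
    (fun {r s} hs n => by
      have := coeff_mulAux_mem (I := ⊤) hI (p := (ofPoly δ).symm r) (fun _ => trivial) hs n
      rwa [Ideal.top_mul] at this)
    (fun {r s} hr n => by
      have := coeff_mulAux_mem (I' := ⊤) (δ := δ) (fun _ _ => trivial) hr
        (q := (ofPoly δ).symm s) (fun _ => trivial) n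
      rwa [Ideal.mul_top] at this)

lemma mem_coeffIdeal {I : Ideal A} {hI : ∀ b ∈ I, δ b ∈ I} {r : OreExtension δ} :
    r ∈ coeffIdeal δ I hI ↔ ∀ n, ((ofPoly δ).symm r).coeff n ∈ I :=
  TwoSidedIdeal.mem_mk' ..

lemma ofPoly_symm_ι (a : A) : (ofPoly δ).symm (ι δ a) = C a := rfl

lemma ι_mem_coeffIdeal {I : Ideal A} {hI : ∀ b ∈ I, δ b ∈ I} {a : A} :
    ι δ a ∈ coeffIdeal δ I hI ↔ a ∈ I := by
  rw [mem_coeffIdeal, ofPoly_symm_ι]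
  refine ⟨fun h => by simpa using h 0, fun h n => ?_⟩
  rw [coeff_C]
  split_ifs
  exacts [h, I.zero_mem]

lemma eq_sum (r : OreExtension δ) :
    r = ((ofPoly δ).symm r).sum fun i a => ι δ a * z δ ^ i := by
  rw [← ofPoly_eq_sum, LinearEquiv.apply_symm_apply]

lemma coeffIdeal_le_iff {I : Ideal A} {hI : ∀ b ∈ I, δ b ∈ I}
    {P : TwoSidedIdeal (OreExtension δ)} :
    coeffIdeal δ I hI ≤ P ↔ ∀ a ∈ I, ι δ a ∈ P := by
  refine ⟨fun h a ha => h (ι_mem_coeffIdeal.2 ha), fun h r hr => ?_⟩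
  rw [mem_coeffIdeal] at hr
  rw [eq_sum r]
  exact sum_mem fun i _ => P.mul_mem_right _ _ (h _ (hr i))

lemma coe_coeffIdeal (I : Ideal A) (hI : ∀ b ∈ I, δ b ∈ I) :
    (coeffIdeal δ I hI : Set (OreExtension δ)) = rightIdealSpan (ι δ '' (I : Set A)) := by
  refine Set.Subset.antisymm (fun r hr => ?_) fun r hr => ?_
  · replace hr := mem_coeffIdeal.1 (SetLike.mem_coe.1 hr)
    rw [eq_sum r]
    refine Submodule.sum_mem _ fun i _ => ?_
    exact Submodule.smul_mem _ (MulOpposite.op (z δ ^ i))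
      (Submodule.subset_span ⟨_, hr i, rfl⟩)
  · refine Submodule.span_induction (p := fun r _ => r ∈ coeffIdeal δ I hI)
      ?_ (zero_mem _) (fun _ _ _ _ => add_mem) (fun s r _ hr => ?_) hr
    · rintro _ ⟨a, ha, rfl⟩
      exact ι_mem_coeffIdeal.2 ha
    · exact TwoSidedIdeal.mul_mem_right _ _ s.unop hr

lemma rightIdealSpan_ι_span_singleton (u : A) :
    rightIdealSpan (ι δ '' (Ideal.span {u} : Set A)) = rightIdealSpan {ι δ u} := by
  refine le_antisymm (Submodule.span_le.2 ?_) (Submodule.span_mono ?_)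
  · rintro _ ⟨a, ha, rfl⟩
    obtain ⟨c, rfl⟩ := Ideal.mem_span_singleton'.1 ha
    rw [mul_comm, map_mul]
    exact Submodule.smul_mem _ (MulOpposite.op (ι δ c)) (Submodule.subset_span rfl)
  · rintro _ rfl
    exact ⟨u, Ideal.mem_span_singleton_self u, rfl⟩

lemma coeffIdeal_bot : coeffIdeal δ (⊥ : Ideal A) (by simp) = ⊥ :=
  le_antisymm (coeffIdeal_le_iff.2 fun a ha => by
    rw [Ideal.mem_bot] at ha; simp [ha]) bot_le

/-- Modulo `p`, each multiplication by `z` shifts the leading term up by one; the terms created by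
`δ` stay in lower degrees. -/
lemma coeff_zMul_pow_of_lt {p : Ideal A} (hp : ∀ b ∈ p, δ b ∈ p) {g : A[X]} {j : ℕ}
    (hg : ∀ l, j < l → g.coeff l ∈ p) (m : ℕ) :
    (∀ l, m + j < l → ((zMul δ ^ m) g).coeff l ∈ p) ∧
      ((zMul δ ^ m) g).coeff (m + j) - g.coeff j ∈ p := by
  induction m with
  | zero => simpa using hg
  | succ m ih =>
    rw [pow_succ', Module.End.mul_apply]
    refine ⟨fun l hl => ?_, ?_⟩
    · obtain ⟨l, rfl⟩ := Nat.exists_eq_succ_of_ne_zero (by omega : l ≠ 0)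
      rw [Nat.succ_eq_add_one, coeff_zMul_succ]
      exact p.add_mem (ih.1 _ (by omega)) (hp _ (ih.1 _ (by omega)))
    · rw [show m + 1 + j = m + j + 1 by ring, coeff_zMul_succ, add_sub_right_comm]
      exact p.add_mem ih.2 (hp _ (ih.1 _ (by omega)))

lemma exists_max_coeff_notMem {p : Ideal A} {f : A[X]} (hf : ¬ ∀ n, f.coeff n ∈ p) :
    ∃ i, f.coeff i ∉ p ∧ ∀ l, i < l → f.coeff l ∈ p := by
  have h0 : f.map (Ideal.Quotient.mk p) ≠ 0 := fun h => hf fun n => by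
    rw [← Ideal.Quotient.eq_zero_iff_mem, ← coeff_map, h, coeff_zero]
  refine ⟨(f.map (Ideal.Quotient.mk p)).natDegree, fun h => ?_, fun l hl => ?_⟩
  · rw [← Ideal.Quotient.eq_zero_iff_mem, ← coeff_map, coeff_natDegree, leadingCoeff_eq_zero] at h
    exact h0 h
  · rw [← Ideal.Quotient.eq_zero_iff_mem, ← coeff_map]
    exact coeff_eq_zero_of_natDegree_lt hl

/-- Leading coefficients modulo `p` multiply, so the extended ideal is even completely prime. -/
lemma mem_or_mem_of_mul_mem_coeffIdeal {p : Ideal A} [p.IsPrime] {hp : ∀ b ∈ p, δ b ∈ p}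
    {r s : OreExtension δ} (h : r * s ∈ coeffIdeal δ p hp) :
    r ∈ coeffIdeal δ p hp ∨ s ∈ coeffIdeal δ p hp := by
  by_contra! hrs
  rw [mem_coeffIdeal, mem_coeffIdeal] at hrs
  obtain ⟨i, hi, hi'⟩ := exists_max_coeff_notMem hrs.1
  obtain ⟨j, hj, hj'⟩ := exists_max_coeff_notMem hrs.2
  set f := (ofPoly δ).symm r
  set g := (ofPoly δ).symm s
  have h1 : (mulAux δ f g).coeff (i + j) ∈ p := mem_coeffIdeal.1 h (i + j)
  have hif : i ∈ f.support := mem_support_iff.2 fun h => hi (h ▸ p.zero_mem)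
  -- In degree `i + j` only the summand of index `i` survives modulo `p`: for `m < i` the degree of
  -- `z^m g` modulo `p` is too small, and for `m > i` the coefficient of `f` is in `p`.
  rw [coeff_mulAux, ← Finset.add_sum_erase _ _ hif, Ideal.add_mem_iff_left] at h1
  · have h2 := p.mul_mem_left (f.coeff i) (coeff_zMul_pow_of_lt hp hj' i).2
    rw [mul_sub] at h2
    replace h2 := p.sub_mem h1 h2
    rw [sub_sub_cancel] at h2
    exact (Ideal.IsPrime.mem_or_mem ‹_› h2).elim hi hj
  · refine Ideal.sum_mem _ fun m hm => ?_
    rcases lt_or_gt_of_ne (Finset.ne_of_mem_erase hm) with hm | hm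
    · exact p.mul_mem_left _ ((coeff_zMul_pow_of_lt hp hj' m).1 _ (by omega))
    · exact p.mul_mem_right _ (hi' _ hm)

lemma isPrimeIdeal_coeffIdeal (p : Ideal A) [hpp : p.IsPrime] (hp : ∀ b ∈ p, δ b ∈ p) :
    (coeffIdeal δ p hp).IsPrimeIdeal := by
  refine ⟨fun h => hpp.ne_top ?_, fun I J hIJ => ?_⟩
  · rw [Ideal.eq_top_iff_one, ← ι_mem_coeffIdeal (hI := hp), h]
    trivial
  · by_contra! h
    obtain ⟨x, hx, hx'⟩ := SetLike.not_le_iff_exists.1 h.1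
    obtain ⟨y, hy, hy'⟩ := SetLike.not_le_iff_exists.1 h.2
    exact (mem_or_mem_of_mul_mem_coeffIdeal (hIJ x hx y hy)).elim hx' hy'

variable (δ) in
/-- Reduction of the coefficients modulo an ideal containing the image of `δ`. -/
noncomputable def reduce (J : Ideal A) (hJ : ∀ b, δ b ∈ J) : OreExtension δ →ₐ[k] (A ⧸ J)[X] :=
  AlgHom.ofLinearMap ((mapAlgHom (Ideal.Quotient.mkₐ k J)).toLinearMap ∘ₗ
      (ofPoly δ).symm.toLinearMap)
    (by
      change Polynomial.map _ (1 : A[X]) = 1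
      simp)
    (fun r s => by
      change Polynomial.map (Ideal.Quotient.mk J)
          (mulAux δ ((ofPoly δ).symm r) ((ofPoly δ).symm s)) =
        Polynomial.map (Ideal.Quotient.mk J) ((ofPoly δ).symm r) *
          Polynomial.map (Ideal.Quotient.mk J) ((ofPoly δ).symm s)
      generalize (ofPoly δ).symm r = p
      generalize (ofPoly δ).symm s = q
      -- Modulo `J` the `δ`-terms vanish, so left multiplication by `z` becomes multiplication by
      -- the central variable.
      have hz : ∀ q : A[X], (zMul δ q).map (Ideal.Quotient.mk J) =
          X * q.map (Ideal.Quotient.mk J) := fun q => by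
        ext n
        cases n with
        | zero => simp [coeff_zMul_zero, Ideal.Quotient.eq_zero_iff_mem.2 (hJ _)]
        | succ n =>
          simp [coeff_zMul_succ, Ideal.Quotient.eq_zero_iff_mem.2 (hJ _), coeff_X_mul]
      have hzi : ∀ i, ((zMul δ ^ i) q).map (Ideal.Quotient.mk J) =
          X ^ i * q.map (Ideal.Quotient.mk J) := fun i => by
        induction i with
        | zero => simp
        | succ i ih => rw [pow_succ', Module.End.mul_apply, hz, ih, pow_succ', mul_assoc]
      induction p using Polynomial.induction_on' with
      | add p p' hp hp' =>
        simp only [map_add, LinearMap.add_apply, Polynomial.map_add, hp, hp', add_mul]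
      | monomial n b =>
        rw [mulAux_monomial, LinearMap.smul_apply, smul_eq_C_mul, Polynomial.map_mul, hzi,
          map_C, Polynomial.map_monomial, ← C_mul_X_pow_eq_monomial, mul_assoc])

lemma reduce_apply (J : Ideal A) (hJ : ∀ b, δ b ∈ J) (r : OreExtension δ) :
    reduce δ J hJ r = ((ofPoly δ).symm r).map (Ideal.Quotient.mk J) := rfl

lemma reduce_eq_zero_iff (J : Ideal A) (hJ : ∀ b, δ b ∈ J) (r : OreExtension δ) :
    reduce δ J hJ r = 0 ↔ r ∈ coeffIdeal δ J fun b _ => hJ b := by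
  rw [reduce_apply, mem_coeffIdeal, Polynomial.ext_iff]
  simp [Ideal.Quotient.eq_zero_iff_mem]

lemma reduce_surjective (J : Ideal A) (hJ : ∀ b, δ b ∈ J) :
    Function.Surjective (reduce δ J hJ) := fun q => by
  obtain ⟨p, rfl⟩ := map_surjective _ Ideal.Quotient.mk_surjective q
  exact ⟨ofPoly δ p, rfl⟩

/-- If `J` contains the image of `δ`, then `A[z; δ] / J A[z; δ]` is `(A / J)[z]`. -/
noncomputable def quotientEquiv (J : Ideal A) (hJ : ∀ b, δ b ∈ J) :
    (coeffIdeal δ J fun b _ => hJ b).ringCon.Quotient ≃ₐ[k] (A ⧸ J)[X] :=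
  AlgEquiv.ofBijective
    (RingCon.liftₐ _ (reduce δ J hJ) fun r s h => by
      rw [TwoSidedIdeal.rel_iff, ← reduce_eq_zero_iff, map_sub, sub_eq_zero] at h
      exact h)
    (by
      refine ⟨?_, fun q => ?_⟩
      · rw [injective_iff_map_eq_zero]
        intro x hx
        obtain ⟨r, rfl⟩ := RingCon.mk'_surjective _ x
        have h : reduce δ J hJ r = 0 := hx
        rw [reduce_eq_zero_iff] at h
        have h' := (RingCon.eq _).2 ((TwoSidedIdeal.mem_iff _ _).1 h)
        exact h'
      · obtain ⟨r, rfl⟩ := reduce_surjective J hJ q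
        exact ⟨RingCon.mk' _ r, rfl⟩)

lemma quotientEquiv_mk' (J : Ideal A) (hJ : ∀ b, δ b ∈ J) (r : OreExtension δ) :
    quotientEquiv J hJ (RingCon.mk' _ r) = reduce δ J hJ r := rfl

/-- A prime ideal containing the kernel of a surjection onto a commutative ring is the preimage
of a prime ideal. -/
lemma _root_.TwoSidedIdeal.IsPrimeIdeal.exists_eq_comap {R S : Type*} [Ring R] [CommRing S]
    {P : TwoSidedIdeal R} (hP : P.IsPrimeIdeal) (f : R →+* S) (hf : Function.Surjective f)
    (hker : ∀ r, f r = 0 → r ∈ P) :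
    ∃ Q : Ideal S, Q.IsPrime ∧ (P : Set R) = {r | f r ∈ Q} := by
  have hmem : ∀ r, f r ∈ Ideal.map f P.asIdeal ↔ r ∈ P := fun r => by
    refine ⟨fun h => ?_, fun h => Ideal.mem_map_of_mem f (TwoSidedIdeal.mem_asIdeal.2 h)⟩
    obtain ⟨s, hs, hsr⟩ := (Ideal.mem_map_iff_of_surjective f hf).1 h
    have := P.add_mem (hker (r - s) (by rw [map_sub, hsr, sub_self]))
      (TwoSidedIdeal.mem_asIdeal.1 hs)
    rwa [sub_add_cancel] at this
  refine ⟨Ideal.map f P.asIdeal, ⟨fun h => hP.1 ?_, fun {x y} hxy => ?_⟩, ?_⟩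
  · rw [← TwoSidedIdeal.one_mem_iff, ← hmem, h]
    trivial
  · obtain ⟨r, rfl⟩ := hf x
    obtain ⟨s, rfl⟩ := hf y
    -- Primeness of `P` is tested on preimages of principal ideals, whose products are controlled
    -- because `S` is commutative.
    let I : S → TwoSidedIdeal R := fun x => (Ideal.span {x}).toTwoSided.comap f
    have hI : ∀ r s, s ∈ I (f r) ↔ f s ∈ Ideal.span {f r} := fun r s => by
      simp [I, TwoSidedIdeal.mem_comap]
    have hself : ∀ r, r ∈ I (f r) := fun r => (hI r r).2 (Ideal.mem_span_singleton_self _)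
    rw [hmem, hmem]
    refine (hP.2 (I (f r)) (I (f s)) fun c hc d hd => ?_).imp (fun h => h (hself r))
      fun h => h (hself s)
    obtain ⟨c', hc'⟩ := Ideal.mem_span_singleton'.1 ((hI r c).1 hc)
    obtain ⟨d', hd'⟩ := Ideal.mem_span_singleton'.1 ((hI s d).1 hd)
    rw [← hmem, map_mul, ← hc', ← hd', show c' * f r * (d' * f s) = c' * d' * (f r * f s) by ring]
    exact Ideal.mul_mem_left _ _ hxy
  · ext r
    exact (hmem r).symm

/-- The preimage of a prime ideal under a homomorphism to a commutative ring is prime. -/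
lemma _root_.TwoSidedIdeal.isPrimeIdeal_of_coe_eq_preimage {R S : Type*} [Ring R] [CommRing S]
    {P : TwoSidedIdeal R} (f : R →+* S) {Q : Ideal S}
    (hQ : Q.IsPrime) (h : (P : Set R) = {r | f r ∈ Q}) : P.IsPrimeIdeal := by
  have hmem : ∀ r, r ∈ P ↔ f r ∈ Q := fun r => Set.ext_iff.1 h r
  refine ⟨fun htop => hQ.ne_top ?_, fun I J hIJ => ?_⟩
  · rw [← TwoSidedIdeal.one_mem_iff, hmem, map_one] at htop
    exact (Ideal.eq_top_iff_one _).2 htop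
  · by_contra! hc
    obtain ⟨x, hx, hx'⟩ := SetLike.not_le_iff_exists.1 hc.1
    obtain ⟨y, hy, hy'⟩ := SetLike.not_le_iff_exists.1 hc.2
    have := hIJ x hx y hy
    rw [hmem, map_mul] at this
    rw [hmem] at hx' hy'
    exact (hQ.mem_or_mem this).elim hx' hy'

end CoeffIdeal

/-! ### Stable ideals in characteristic zero and contractions of primes -/

section DifferentialIdeal

variable {k A : Type*} [Field k] [CommRing A] [Algebra k A] {δ : Derivation k A A}

variable (k) in
lemma mem_of_natCast_mul_mem [CharZero k] {I : Ideal A} {n : ℕ} (hn : n ≠ 0) {x : A}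
    (h : (n : A) * x ∈ I) : x ∈ I := by
  have h' := I.mul_mem_left (algebraMap k A (n : k)⁻¹) h
  rwa [← mul_assoc, ← map_natCast (algebraMap k A), ← map_mul,
    inv_mul_cancel₀ (Nat.cast_ne_zero.2 hn), map_one, one_mul] at h'

/-- In characteristic zero, the radical of a `δ`-stable ideal is `δ`-stable. -/
lemma derivation_mem_radical [CharZero k] {I : Ideal A} (hI : ∀ b ∈ I, δ b ∈ I) {f : A}
    (hf : f ∈ I.radical) : δ f ∈ I.radical := by
  obtain ⟨n, hn⟩ := hf
  -- Each step trades one factor `f` for two factors `δ f`: differentiate, multiply by `δ f`, remove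
  -- the term containing `δ (δ f)`, and cancel the integer factor.
  have key : ∀ i ≤ n, f ^ (n - i) * δ f ^ (2 * i) ∈ I := fun i => by
    induction i with
    | zero => simpa using hn
    | succ i ih =>
      intro hi
      obtain ⟨m, rfl⟩ := Nat.exists_eq_add_of_le hi
      have h := ih (by omega)
      rw [show i + 1 + m - i = m + 1 by omega] at h
      rw [show i + 1 + m - (i + 1) = m by omega]
      have h1 := I.mul_mem_left (δ f) (hI _ h)
      refine mem_of_natCast_mul_mem k (Nat.succ_ne_zero m) ?_
      have h2 := I.mul_mem_left ((2 * i : ℕ) * δ (δ f)) h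
      convert I.sub_mem h1 h2 using 1
      rw [Derivation.leibniz, Derivation.leibniz_pow, Derivation.leibniz_pow]
      -- The exponent `2 * i - 1` is truncated at `i = 0`.
      rcases i with _ | i
      · simp; ring
      · rw [show 2 * (i + 1) - 1 = 2 * i + 1 by omega]
        simp only [smul_eq_mul, nsmul_eq_mul, Nat.add_sub_cancel]
        push_cast
        ring
  exact ⟨2 * n, by simpa using key n le_rfl⟩

lemma derivation_mem_pow {I : Ideal A} (hI : ∀ b ∈ I, δ b ∈ I) (n : ℕ) :
    ∀ b ∈ I ^ n, δ b ∈ I ^ n := by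
  induction n with
  | zero => simp
  | succ n ih =>
    intro b hb
    rw [pow_succ] at hb ⊢
    refine Submodule.mul_induction_on hb (fun x hx y hy => ?_) fun x y hx hy => ?_
    · rw [Derivation.leibniz, smul_eq_mul, smul_eq_mul]
      exact Ideal.add_mem _ (Ideal.mul_mem_mul hx (hI y hy))
        (by rw [mul_comm y]; exact Ideal.mul_mem_mul (ih x hx) hy)
    · rw [map_add]
      exact Ideal.add_mem _ hx hy

/-- In a Noetherian algebra of characteristic zero, a `δ`-prime ideal is prime. -/
lemma isPrime_of_forall_differential [CharZero k] [IsNoetherianRing A] {p : Ideal A}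
    (hp : ∀ b ∈ p, δ b ∈ p) (hne : p ≠ ⊤)
    (h : ∀ I I' : Ideal A, (∀ b ∈ I, δ b ∈ I) → (∀ b ∈ I', δ b ∈ I') → I * I' ≤ p →
      I ≤ p ∨ I' ≤ p) : p.IsPrime := by
  -- The radical is stable and some power of it lies in `p`, so the hypothesis on stable ideals
  -- peels off one factor at a time.
  have hrad : p.radical ≤ p := by
    obtain ⟨n, hn⟩ := p.exists_radical_pow_le_of_fg (IsNoetherian.noetherian _)
    have hst : ∀ b ∈ p.radical, δ b ∈ p.radical := fun b => derivation_mem_radical hp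
    induction n with
    | zero => exact absurd (top_le_iff.1 (by simpa using hn)) hne
    | succ n ih =>
      rw [pow_succ] at hn
      exact (h _ _ (derivation_mem_pow hst n) hst hn).elim ih id
  refine ⟨hne, fun {x y} hxy => ?_⟩
  -- The ideals `(p : y)` and `(p : (p : y))` contain `x` and `y` respectively, and their product
  -- lies in `p`. They are stable because `p` is radical.
  let I : Ideal A := p.colon {y}
  have hI : ∀ b, b ∈ I ↔ b * y ∈ p := fun b => by simp [I, Submodule.mem_colon_singleton]
  let I' : Ideal A := p.colon (I : Set A)
  have hI' : ∀ c, c ∈ I' ↔ ∀ b ∈ I, c * b ∈ p := fun c => by simp [I', Submodule.mem_colon]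
  have hIst : ∀ b ∈ I, δ b ∈ I := fun b hb => by
    rw [hI] at hb ⊢
    -- Multiplying `δ (b y)` by `δ b * y` yields `(δ b * y)^2` up to a multiple of `b y`.
    refine hrad ⟨2, ?_⟩
    have h1 := p.mul_mem_left (δ b * y) (hp _ hb)
    rw [Derivation.leibniz, smul_eq_mul, smul_eq_mul] at h1
    have h2 := p.mul_mem_left (δ b * δ y) hb
    convert p.sub_mem h1 h2 using 1
    ring
  have hIst' : ∀ b ∈ I', δ b ∈ I' := fun c hc => by
    rw [hI'] at hc ⊢
    intro b hb
    have h1 := hp _ (hc b hb)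
    rw [Derivation.leibniz, smul_eq_mul, smul_eq_mul] at h1
    have h2 := hc _ (hIst b hb)
    convert p.sub_mem h1 h2 using 1
    ring
  refine (h I I' hIst hIst' (Ideal.mul_le.2 fun b hb c hc => ?_)).imp (fun hle => ?_) fun hle => ?_
  · rw [mul_comm]
    exact (hI' c).1 hc b hb
  · exact hle ((hI x).2 hxy)
  · exact hle ((hI' y).2 fun b hb => by rw [mul_comm]; exact (hI b).1 hb)

variable (δ) in
/-- The ideal of coefficients contained in a two-sided ideal of `A[z; δ]`. -/
noncomputable def contraction (P : TwoSidedIdeal (OreExtension δ)) : Ideal A :=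
  P.asIdeal.comap (ι δ : A →+* OreExtension δ)

lemma mem_contraction {P : TwoSidedIdeal (OreExtension δ)} {b : A} :
    b ∈ contraction δ P ↔ ι δ b ∈ P := Iff.rfl

lemma derivation_mem_contraction (P : TwoSidedIdeal (OreExtension δ)) :
    ∀ b ∈ contraction δ P, δ b ∈ contraction δ P := fun b hb => by
  rw [mem_contraction] at hb ⊢
  have h := P.sub_mem (P.mul_mem_left (z δ) _ hb) (P.mul_mem_right _ (z δ) hb)
  rwa [z_mul_ι, add_sub_cancel_left] at h

/-- For stable `I`, `I'` with `I I' ⊆ p`, the product of the extended ideals has coefficients in `I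
I'`, hence lies in `P`; so primeness of `P` descends to stable ideals of `A`. -/
lemma isPrime_contraction [CharZero k] [IsNoetherianRing A] {P : TwoSidedIdeal (OreExtension δ)}
    (hP : P.IsPrimeIdeal) : (contraction δ P).IsPrime := by
  refine isPrime_of_forall_differential (derivation_mem_contraction P) (fun h => hP.1 ?_)
    fun I I' hI hI' hII' => ?_
  · rw [← TwoSidedIdeal.one_mem_iff, ← map_one (ι δ), ← mem_contraction, h]
    trivial
  · refine (hP.2 (coeffIdeal δ I hI) (coeffIdeal δ I' hI') fun r hr s hs => ?_).imp
      (fun h => coeffIdeal_le_iff.1 h) (fun h => coeffIdeal_le_iff.1 h)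
    have hle : coeffIdeal δ (contraction δ P) (derivation_mem_contraction P) ≤ P :=
      coeffIdeal_le_iff.2 fun a ha => ha
    exact hle (mem_coeffIdeal.2 fun n =>
      hII' (coeff_mulAux_mem hI' (mem_coeffIdeal.1 hr) (mem_coeffIdeal.1 hs) n))

/-- These are the two top terms of `z^m b = b z^m + m δ(b) z^(m-1) + ...`; the second is stated for
`m + 1` to avoid subtraction. -/
lemma coeff_zMul_pow_C (b : A) (m : ℕ) :
    (∀ l, m < l → ((zMul δ ^ m) (C b)).coeff l = 0) ∧ ((zMul δ ^ m) (C b)).coeff m = b ∧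
      ((zMul δ ^ (m + 1)) (C b)).coeff m = (m + 1 : ℕ) * δ b := by
  induction m with
  | zero =>
    refine ⟨fun l hl => ?_, by simp, ?_⟩
    · simp [coeff_C, hl.ne']
    · simp [coeff_zMul_zero]
  | succ m ih =>
    rw [pow_succ' (zMul δ) (m + 1), Module.End.mul_apply]
    have h0 : ∀ l, m + 1 < l → ((zMul δ ^ (m + 1)) (C b)).coeff l = 0 := fun l hl => by
      obtain ⟨l, rfl⟩ := Nat.exists_eq_succ_of_ne_zero (by omega : l ≠ 0)
      rw [pow_succ', Module.End.mul_apply, Nat.succ_eq_add_one, coeff_zMul_succ,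
        ih.1 _ (by omega), ih.1 _ (by omega), map_zero, add_zero]
    have h1 : ((zMul δ ^ (m + 1)) (C b)).coeff (m + 1) = b := by
      rw [pow_succ', Module.End.mul_apply, coeff_zMul_succ, ih.2.1, ih.1 _ (by omega), map_zero,
        add_zero]
    refine ⟨h0, h1, ?_⟩
    rw [coeff_zMul_succ, ih.2.2, h1]
    push_cast
    ring

/-- The commutator with `b` lowers the degree, and its top coefficient carries the factor `δ b`.
This drives the degree induction in `eq_coeffIdeal_contraction`. -/
lemma coeff_mulAux_C (q : A[X]) (b : A) {m : ℕ} (hq : ∀ l, m + 1 < l → q.coeff l = 0) :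
    (∀ l, m < l → (mulAux δ q (C b) - b • q).coeff l = 0) ∧
      (mulAux δ q (C b) - b • q).coeff m = (m + 1 : ℕ) * (q.coeff (m + 1) * δ b) := by
  have hdeg : q.natDegree < m + 2 := by
    rw [Nat.lt_succ_iff, natDegree_le_iff_coeff_eq_zero]
    exact hq
  have hco : ∀ l, (mulAux δ q (C b) - b • q).coeff l =
      ∑ i ∈ Finset.range (m + 2), q.coeff i * ((zMul δ ^ i) (C b)).coeff l - b * q.coeff l :=
    fun l => by
      rw [coeff_sub, coeff_smul, smul_eq_mul, coeff_mulAux]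
      congr 1
      refine Finset.sum_subset (fun i hi => ?_) fun i _ hi => ?_
      · exact Finset.mem_range.2 ((le_natDegree_of_mem_supp i hi).trans_lt hdeg)
      · rw [notMem_support_iff.1 hi, zero_mul]
  have hlt : ∀ n l, n ≤ l → ∑ i ∈ Finset.range n, q.coeff i * ((zMul δ ^ i) (C b)).coeff l = 0 :=
    fun n l hl => Finset.sum_eq_zero fun i hi => by
      rw [(coeff_zMul_pow_C b i).1 l (by have := Finset.mem_range.1 hi; omega), mul_zero]
  refine ⟨fun l hl => ?_, ?_⟩
  · rw [hco]
    rcases (by omega : l = m + 1 ∨ m + 1 < l) with rfl | hl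
    · rw [Finset.sum_range_succ, hlt _ _ le_rfl, (coeff_zMul_pow_C b _).2.1]
      ring
    · rw [hlt _ _ (by omega), hq l hl]
      ring
  · rw [hco, Finset.sum_range_succ, Finset.sum_range_succ, hlt _ _ le_rfl,
      (coeff_zMul_pow_C b m).2.1, (coeff_zMul_pow_C b m).2.2]
    ring

/-- A two-sided ideal whose contraction is a prime ideal not containing the image of `δ` is
generated by its contraction. -/
lemma eq_coeffIdeal_contraction [CharZero k] {P : TwoSidedIdeal (OreExtension δ)}
    [hp : (contraction δ P).IsPrime] {b : A} (hb : δ b ∉ contraction δ P) :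
    P = coeffIdeal δ (contraction δ P) (derivation_mem_contraction P) := by
  set p := contraction δ P with hpdef
  have hle : coeffIdeal δ p (derivation_mem_contraction P) ≤ P :=
    coeffIdeal_le_iff.2 fun a ha => ha
  refine le_antisymm (fun r hr => ?_) hle
  -- Induction on a degree bound. The commutator with `b` puts `(m + 1) * q.coeff (m + 1) * δ b` in
  -- `p`, hence also `q.coeff (m + 1)`; removing that top term allows the induction hypothesis to be
  -- used again.
  have key : ∀ (n : ℕ) (q : A[X]), (∀ l, n < l → q.coeff l = 0) → ofPoly δ q ∈ P →
      ∀ l, q.coeff l ∈ p := fun n => by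
    induction n with
    | zero =>
      intro q hq hqP
      rw [eq_C_of_natDegree_le_zero (natDegree_le_iff_coeff_eq_zero.2 hq)] at hqP ⊢
      exact mem_coeffIdeal.1 (ι_mem_coeffIdeal (hI := derivation_mem_contraction P).2 hqP)
    | succ m ih =>
      intro q hq hqP
      have hmem : ofPoly δ (mulAux δ q (C b) - b • q) ∈ P := by
        have h2 := P.sub_mem (P.mul_mem_right _ (ι δ b) hqP) (P.mul_mem_left (ι δ b) _ hqP)
        have h3 : ι δ b * ofPoly δ q = ofPoly δ (b • q) := by
          change ofPoly δ (monomial 0 b) * ofPoly δ q = _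
          rw [ofPoly_mul_ofPoly, mulAux_monomial, pow_zero, LinearMap.smul_apply,
            Module.End.one_apply]
        rw [h3] at h2
        exact h2
      obtain ⟨h0, h1⟩ := coeff_mulAux_C (δ := δ) q b hq
      have h4 := ih _ h0 hmem m
      rw [h1] at h4
      have h5 : q.coeff (m + 1) ∈ p :=
        (hp.mem_or_mem (mem_of_natCast_mul_mem k m.succ_ne_zero h4)).resolve_right hb
      have h6 : ofPoly δ (monomial (m + 1) (q.coeff (m + 1))) ∈ P := by
        rw [← ι_mul_z_pow]
        exact P.mul_mem_right _ _ h5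
      have h7 := ih (q - monomial (m + 1) (q.coeff (m + 1))) (fun l hl => by
        rw [coeff_sub, coeff_monomial]
        split_ifs with h
        · rw [h, sub_self]
        · rw [hq l (by omega), sub_zero]) (by rw [map_sub]; exact P.sub_mem hqP h6)
      intro l
      by_cases hl : m + 1 = l
      · rwa [← hl]
      · simpa [coeff_monomial, hl] using h7 l
  exact mem_coeffIdeal.2 (key _ ((ofPoly δ).symm r)
    (natDegree_le_iff_coeff_eq_zero.1 le_rfl) hr)

/-- If the image of `b` in `A / p` is a root of a nonzero polynomial whose coefficients lift to
constants, then `δ b` vanishes modulo `p`. -/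
lemma derivation_mem_of_eval_mem [CharZero k] {p : Ideal A} [hpp : p.IsPrime]
    (hp : ∀ b ∈ p, δ b ∈ p) {b : A} (q : A[X]) (hq : ∀ n, δ (q.coeff n) = 0) (hq0 : q.map (Ideal.Quotient.mk p) ≠ 0)
    (hb : q.eval b ∈ p) : δ b ∈ p := by
  have : CharZero (A ⧸ p) := charZero_of_injective_algebraMap (algebraMap k (A ⧸ p)).injective
  -- Applying `δ` to `q(b)` gives `q'(b) δ b ∈ p`; if `δ b ∉ p`, then `q'` replaces `q` with smaller
  -- degree.
  induction hn : q.natDegree using Nat.strong_induction_on generalizing q with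
  | _ n ih =>
    have hb' : (q.map (Ideal.Quotient.mk p)).eval (Ideal.Quotient.mk p b) = 0 := by
      rw [eval_map_apply, Ideal.Quotient.eq_zero_iff_mem]
      exact hb
    -- A zero derivative would make `q` constant modulo `p`, and its root forces that constant to be
    -- zero.
    have hd0 : (derivative q).map (Ideal.Quotient.mk p) ≠ 0 := fun h => by
      rw [← derivative_map] at h
      have h' := eq_C_of_derivative_eq_zero h
      rw [h', eval_C] at hb'
      rw [h', hb', map_zero] at hq0
      exact hq0 rfl
    have hn0 : n ≠ 0 := fun h => hd0 (by
      rw [derivative_of_natDegree_zero (hn.trans h), Polynomial.map_zero])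
    have h := hp _ hb
    have heval : δ (q.eval b) = (derivative q).eval b * δ b := by
      rw [derivative_eval, eval_eq_sum, Polynomial.sum_def, Polynomial.sum_def, map_sum,
        Finset.sum_mul]
      refine Finset.sum_congr rfl fun i _ => ?_
      rw [Derivation.leibniz, hq, Derivation.leibniz_pow]
      simp only [smul_eq_mul, nsmul_eq_mul, mul_zero, add_zero]
      ring
    rw [heval] at h
    refine (hpp.mem_or_mem h).elim (fun h => ?_) id
    refine ih _ (hn ▸ natDegree_derivative_lt (hn.trans_ne hn0)) _ (fun m => ?_) hd0 h rfl
    rw [coeff_derivative, Derivation.leibniz, hq, ← Nat.cast_succ, Derivation.map_natCast]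
    simp

end DifferentialIdeal

end OreExtension

/-! ### Algebraic dependence in quotients of `ℂ[x, y]` -/

section Transcendence

open Algebra

/-- Lifting an algebraically independent family along a homomorphism that kills a nonzero
element `h`, and adjoining `h`, yields an algebraically independent family. -/
lemma AlgebraicIndependent.option_of_comp_of_map_eq_zero {k A B ι : Type*} [Field k] [CommRing A]
    [IsDomain A] [CommRing B] [Algebra k A] [Algebra k B] (f : A →ₐ[k] B) {x : ι → A}
    (hx : AlgebraicIndependent k (f ∘ x)) {h : A} (h0 : h ≠ 0) (hf : f h = 0) :
    AlgebraicIndependent k (fun o : Option ι => o.elim h x) := by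
  have hxA := AlgebraicIndependent.of_comp f hx
  rw [hxA.option_iff_transcendental]
  intro halg
  -- If `h` were algebraic it would divide a nonzero `s` in the subalgebra generated by `x`; then
  -- `f` kills `s`, although `f` is injective on that subalgebra.
  obtain ⟨⟨s, hs⟩, hs0, hdvd⟩ := halg.exists_nonzero_dvd (mem_nonZeroDivisors_of_ne_zero h0)
  have hfs : f s = 0 := by
    obtain ⟨c, hc⟩ := hdvd
    have hc' : s = h * c := hc
    rw [hc', map_mul, hf, zero_mul]
  rw [adjoin_range_eq_range_aeval] at hs
  obtain ⟨q, rfl⟩ := hs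
  have hq : MvPolynomial.aeval (f ∘ x) q = 0 := by
    rw [← hfs]
    exact (MvPolynomial.comp_aeval_apply x f q).symm
  have hq0 := hx.eq_zero_of_aeval_eq_zero q hq
  subst hq0
  exact hs0 (Subtype.ext (map_zero _))

/-- The index type has three elements and the transcendence degree is two; the nested `Option`
records adjoining one element to a family twice. -/
lemma not_algebraicIndependent_option_option {x : Option (Option Unit) → PolyXY} :
    ¬ AlgebraicIndependent ℂ x := fun h => by
  have := h.cardinalMk_le_trdeg
  rw [MvPolynomial.trdeg_of_isDomain] at this
  norm_num at this

/-- Any two elements of a proper quotient of `ℂ[x, y]` are algebraically dependent. -/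
lemma isAlgebraic_adjoin_mk {p : Ideal PolyXY} (hp0 : p ≠ ⊥) {a : PolyXY}
    (ha : Transcendental ℂ (Ideal.Quotient.mk p a)) (b : PolyXY) :
    IsAlgebraic (adjoin ℂ {Ideal.Quotient.mk p a}) (Ideal.Quotient.mk p b) := by
  by_contra hb
  obtain ⟨h, hp, h0⟩ := Submodule.exists_mem_ne_zero_of_ne_bot hp0
  have hind : AlgebraicIndependent ℂ fun _ : Unit => Ideal.Quotient.mk p a :=
    algebraicIndependent_unique_type_iff.2 ha
  have h2 := (hind.option_iff_transcendental (Ideal.Quotient.mk p b)).2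
    (by rwa [Set.range_const])
  have h3 : (fun o : Option Unit => o.elim (Ideal.Quotient.mk p b) fun _ =>
      Ideal.Quotient.mk p a) = Ideal.Quotient.mkₐ ℂ p ∘ fun o : Option Unit =>
        o.elim b fun _ => a := by
    funext o; cases o <;> rfl
  rw [h3] at h2
  exact not_algebraicIndependent_option_option
    (AlgebraicIndependent.option_of_comp_of_map_eq_zero _ h2 h0
      (Ideal.Quotient.eq_zero_iff_mem.2 hp))

/-- If `p` properly contains a nonzero prime ideal, then `ℂ[x, y] / p` is algebraic over `ℂ`. -/
lemma isAlgebraic_mk_of_lt {p' p : Ideal PolyXY} [p'.IsPrime] (hp0 : p' ≠ ⊥) (hlt : p' < p)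
    (b : PolyXY) : IsAlgebraic ℂ (Ideal.Quotient.mk p b) := by
  by_contra hb
  obtain ⟨h, hp, h0⟩ := Submodule.exists_mem_ne_zero_of_ne_bot hp0
  obtain ⟨g, hg, hg'⟩ := SetLike.exists_of_lt hlt
  have hind : AlgebraicIndependent ℂ (Ideal.Quotient.factorₐ ℂ hlt.le ∘
      fun _ : Unit => Ideal.Quotient.mk p' b) :=
    algebraicIndependent_unique_type_iff.2 hb
  have h2 := AlgebraicIndependent.option_of_comp_of_map_eq_zero
    -- Two lifts are made: from `A/p` to `A/p'`, adjoining `g`, then to `A`, adjoining `h`. This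
    -- gives three independent elements.
    (h := Ideal.Quotient.mk p' g) _ hind
    (fun h => hg' (Ideal.Quotient.eq_zero_iff_mem.1 h)) (Ideal.Quotient.eq_zero_iff_mem.2 hg)
  have h3 : (fun o : Option Unit => o.elim (Ideal.Quotient.mk p' g) fun _ =>
      Ideal.Quotient.mk p' b) = Ideal.Quotient.mkₐ ℂ p' ∘ fun o : Option Unit =>
        o.elim g fun _ => b := by
    funext o; cases o <;> rfl
  rw [h3] at h2
  exact not_algebraicIndependent_option_option
    (AlgebraicIndependent.option_of_comp_of_map_eq_zero _ h2 h0
      (Ideal.Quotient.eq_zero_iff_mem.2 hp))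

/-- An algebraic element of a domain over an algebraically closed field is a scalar. -/
lemma IsAlgebraic.exists_algebraMap_eq {k B : Type*} [Field k] [IsAlgClosed k] [CommRing B]
    [IsDomain B] [Algebra k B] {x : B} (hx : IsAlgebraic k x) : ∃ c : k, algebraMap k B c = x :=
  minpoly.mem_range_of_degree_eq_one k x (IsAlgClosed.degree_eq_one_of_irreducible k
    (minpoly.irreducible hx.isIntegral))

end Transcendence

/-! ### The Hamiltonian derivation and the fibers of `a` -/

section Hamiltonian

variable {a : PolyXY} {δ : Derivation ℂ PolyXY PolyXY}

lemma hamiltonian_apply (hδx : δ (MvPolynomial.X 0) = MvPolynomial.pderiv 1 a)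
    (hδy : δ (MvPolynomial.X 1) = -MvPolynomial.pderiv 0 a) (b : PolyXY) :
    δ b = MvPolynomial.pderiv 1 a * MvPolynomial.pderiv 0 b -
      MvPolynomial.pderiv 0 a * MvPolynomial.pderiv 1 b := by
  have h : δ = MvPolynomial.pderiv 1 a • MvPolynomial.pderiv 0 -
      MvPolynomial.pderiv 0 a • MvPolynomial.pderiv 1 := by
    refine MvPolynomial.derivation_ext fun i => ?_
    fin_cases i <;> simp [hδx, hδy, MvPolynomial.pderiv_X]
  conv_lhs => rw [h]
  rfl

lemma hamiltonian_self (hδx : δ (MvPolynomial.X 0) = MvPolynomial.pderiv 1 a)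
    (hδy : δ (MvPolynomial.X 1) = -MvPolynomial.pderiv 0 a) : δ a = 0 := by
  rw [hamiltonian_apply hδx hδy]
  ring

lemma hamiltonian_mem_gradIdeal (hδx : δ (MvPolynomial.X 0) = MvPolynomial.pderiv 1 a)
    (hδy : δ (MvPolynomial.X 1) = -MvPolynomial.pderiv 0 a) (b : PolyXY) :
    δ b ∈ gradIdeal a := by
  rw [hamiltonian_apply hδx hδy]
  exact Ideal.sub_mem _ (Ideal.mul_mem_right _ _ (Ideal.subset_span (by simp)))
    (Ideal.mul_mem_right _ _ (Ideal.subset_span (by simp)))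

lemma gradIdeal_le (hδx : δ (MvPolynomial.X 0) = MvPolynomial.pderiv 1 a)
    (hδy : δ (MvPolynomial.X 1) = -MvPolynomial.pderiv 0 a) {p : Ideal PolyXY}
    (hp : ∀ b, δ b ∈ p) : gradIdeal a ≤ p := by
  refine Ideal.span_le.2 ?_
  rintro _ (rfl | rfl)
  · rw [← hδx]; exact hp _
  · rw [← neg_neg (MvPolynomial.pderiv 0 a), ← hδy]; exact p.neg_mem (hp _)

/-- Modulo a stable prime ideal, a derivation kills the elements that are algebraic over `ℂ`. -/
lemma derivation_mem_of_isAlgebraic {p : Ideal PolyXY} [p.IsPrime]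
    (hp : ∀ b ∈ p, δ b ∈ p) {b : PolyXY} (hb : IsAlgebraic ℂ (Ideal.Quotient.mk p b)) :
    δ b ∈ p := by
  obtain ⟨q, hq0, hq⟩ := hb
  refine OreExtension.derivation_mem_of_eval_mem hp (q.map (algebraMap ℂ PolyXY)) (fun n => ?_) ?_ ?_
  · rw [coeff_map, Derivation.map_algebraMap]
  · rw [Polynomial.map_map, Polynomial.map_ne_zero_iff]
    · exact hq0
    · exact (algebraMap ℂ (PolyXY ⧸ p)).injective
  · rw [eval_map_algebraMap, ← Ideal.Quotient.eq_zero_iff_mem, ← hq]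
    exact (aeval_algHom_apply (Ideal.Quotient.mkₐ ℂ p) b q).symm

/-- Modulo `p` every `b` is algebraic over `ℂ[a]`, whose elements lift to polynomials in `a`, all
killed by `δ`. -/
lemma derivation_mem_of_transcendental {p : Ideal PolyXY} [p.IsPrime]
    (hp : ∀ b ∈ p, δ b ∈ p) (hp0 : p ≠ ⊥) (hδa : δ a = 0)
    (ha : Transcendental ℂ (Ideal.Quotient.mk p a)) (b : PolyXY) : δ b ∈ p := by
  obtain ⟨q, hq0, hq⟩ := isAlgebraic_adjoin_mk hp0 ha b
  have hlift : ∀ s : Algebra.adjoin ℂ {Ideal.Quotient.mk p a}, ∃ c : PolyXY,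
      Ideal.Quotient.mk p c = s ∧ δ c = 0 := fun ⟨s, hs⟩ => by
    rw [Algebra.adjoin_singleton_eq_range_aeval] at hs
    obtain ⟨g, rfl⟩ := hs
    refine ⟨aeval a g, (aeval_algHom_apply (Ideal.Quotient.mkₐ ℂ p) a g).symm, ?_⟩
    rw [Derivation.map_aeval, hδa, smul_zero]
  choose c hc hδc using hlift
  let Q : PolyXY[X] := q.sum fun i s => monomial i (c s)
  -- The chosen lift `c` need not send zero to zero, hence the case distinction on the support.
  have hQ : ∀ n, Q.coeff n = if n ∈ q.support then c (q.coeff n) else 0 := fun n => by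
    simp only [Q, Polynomial.sum_def, finsetSum_coeff, coeff_monomial]
    simp
  have hQmap : Q.map (Ideal.Quotient.mk p) =
      q.map (Algebra.adjoin ℂ {Ideal.Quotient.mk p a}).val.toRingHom := by
    ext n
    rw [coeff_map, coeff_map, hQ]
    split_ifs with h
    · exact hc _
    · rw [notMem_support_iff.1 h, map_zero, map_zero]
  refine OreExtension.derivation_mem_of_eval_mem hp Q (fun n => ?_) ?_ ?_
  · rw [hQ]
    split_ifs
    exacts [hδc _, map_zero _]
  · rw [hQmap, Polynomial.map_ne_zero_iff]
    · exact hq0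
    · exact Subtype.val_injective
  · rw [← Ideal.Quotient.eq_zero_iff_mem, ← eval_map_apply, hQmap, ← hq, eval_map, aeval_def]
    rfl

lemma hamiltonian_eq_zero_of_constant (hc : ∃ c, a = MvPolynomial.C c)
    (hδx : δ (MvPolynomial.X 0) = MvPolynomial.pderiv 1 a)
    (hδy : δ (MvPolynomial.X 1) = -MvPolynomial.pderiv 0 a) (b : PolyXY) : δ b = 0 := by
  obtain ⟨c, rfl⟩ := hc
  simp [hamiltonian_apply hδx hδy]

/-- A nonzero `δ`-stable prime ideal not containing the image of `δ` is generated by an irreducible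
factor of a fiber of `a`. -/
lemma exists_isFiberFactor_of_stable (hδx : δ (MvPolynomial.X 0) = MvPolynomial.pderiv 1 a)
    (hδy : δ (MvPolynomial.X 1) = -MvPolynomial.pderiv 0 a) {p : Ideal PolyXY} [hpp : p.IsPrime]
    (hp : ∀ b ∈ p, δ b ∈ p) (hp0 : p ≠ ⊥) {b : PolyXY} (hb : δ b ∉ p) :
    ∃ u, IsFiberFactor a u ∧ p = Ideal.span {u} := by
  have halg : IsAlgebraic ℂ (Ideal.Quotient.mk p a) := by
    by_contra h
    exact hb (derivation_mem_of_transcendental hp hp0 (hamiltonian_self hδx hδy) h b)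
  obtain ⟨c, hc⟩ := halg.exists_algebraMap_eq
  have hmem : a - MvPolynomial.C c ∈ p := by
    rw [← Ideal.Quotient.eq_zero_iff_mem, map_sub, ← hc, sub_eq_zero]
    rfl
  have hne : a - MvPolynomial.C c ≠ 0 := fun h => hb (by
    rw [hamiltonian_eq_zero_of_constant ⟨c, sub_eq_zero.1 h⟩ hδx hδy]
    exact p.zero_mem)
  have hnu : ¬ IsUnit (a - MvPolynomial.C c) := fun h =>
    hpp.ne_top (Ideal.eq_top_of_isUnit_mem _ hmem h)
  obtain ⟨u, hu, hup⟩ : ∃ u ∈ UniqueFactorizationMonoid.factors (a - MvPolynomial.C c), u ∈ p := by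
    refine (hpp.multiset_prod_mem_iff_exists_mem _).1 ?_
    exact (Ideal.mem_iff_of_associated (UniqueFactorizationMonoid.factors_prod hne)).2 hmem
  refine ⟨u, ⟨c, hne, hnu, UniqueFactorizationMonoid.irreducible_of_factor u hu,
    UniqueFactorizationMonoid.dvd_of_mem_factors hu⟩, ?_⟩
  have hprime := UniqueFactorizationMonoid.prime_of_factor u hu
  have : (Ideal.span {u}).IsPrime := (Ideal.span_singleton_prime hprime.ne_zero).2 hprime
  -- If `(u)` were strictly smaller than `p`, then `A/p` would be algebraic over `ℂ`, so `δ b ∈ p`.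
  by_contra hpu
  have hlt : Ideal.span {u} < p :=
    lt_of_le_of_ne ((Ideal.span_singleton_le_iff_mem _).2 hup) (Ne.symm hpu)
  exact hb (derivation_mem_of_isAlgebraic hp (isAlgebraic_mk_of_lt
    (by simpa using hprime.ne_zero) hlt b))

lemma IsFiberFactor.isPrime_span {u : PolyXY} (hu : IsFiberFactor a u) :
    (Ideal.span {u}).IsPrime := by
  obtain ⟨c, -, -, hirr, -⟩ := hu
  exact (Ideal.span_singleton_prime hirr.ne_zero).2 hirr.prime

/-- Write `a - c = u^(m+1) v` with `u ∤ v` and apply `δ`: after cancelling `u^m`, `u` divides `(m +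
1) v δ(u)`, hence `δ(u)`. -/
lemma IsFiberFactor.derivation_mem_span {u : PolyXY} (hu : IsFiberFactor a u) (hδa : δ a = 0) :
    ∀ b ∈ Ideal.span {u}, δ b ∈ Ideal.span {u} := by
  have hpr := hu.isPrime_span
  obtain ⟨c, hne, -, hirr, hdvd⟩ := hu
  have hdu : δ u ∈ Ideal.span {u} := by
    obtain ⟨v, he, hv⟩ := (FiniteMultiplicity.of_not_isUnit hirr.not_isUnit
      hne).exists_eq_pow_mul_and_not_dvd
    obtain ⟨m, hm⟩ := Nat.exists_eq_succ_of_ne_zero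
      (n := multiplicity u (a - MvPolynomial.C c)) fun hm => hv (by
        rwa [he, hm, pow_zero, one_mul] at hdvd)
    rw [hm] at he
    have h0 : δ (a - MvPolynomial.C c) = 0 := by
      rw [map_sub, hδa, ← MvPolynomial.algebraMap_eq, Derivation.map_algebraMap, sub_zero]
    rw [he, Derivation.leibniz, Derivation.leibniz_pow] at h0
    simp only [smul_eq_mul, nsmul_eq_mul, Nat.succ_eq_add_one, Nat.add_sub_cancel] at h0
    have h1 : u ^ m * (u * δ v + ((m + 1 : ℕ) : PolyXY) * (v * δ u)) = 0 := by
      rw [← h0]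
      ring
    have h2 := (mul_eq_zero.1 h1).resolve_left (pow_ne_zero m hirr.ne_zero)
    have h3 : ((m + 1 : ℕ) : PolyXY) * (v * δ u) ∈ Ideal.span {u} := by
      rw [eq_neg_of_add_eq_zero_right h2, ← mul_neg]
      exact Ideal.mul_mem_right _ _ (Ideal.mem_span_singleton_self u)
    refine (hpr.mem_or_mem (OreExtension.mem_of_natCast_mul_mem ℂ m.succ_ne_zero h3)).resolve_left
      fun h => hv (Ideal.mem_span_singleton.1 h)
  intro b hb
  obtain ⟨d, rfl⟩ := Ideal.mem_span_singleton'.1 hb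
  rw [Derivation.leibniz, smul_eq_mul, smul_eq_mul]
  exact Ideal.add_mem _ (Ideal.mul_mem_left _ _ hdu)
    (Ideal.mul_mem_right _ _ (Ideal.mem_span_singleton_self u))

/-- A prime ideal of `A[z; δ]` whose contraction does not contain the image of `δ` is zero or
generated by an irreducible factor of a fiber of `a`. -/
lemma TwoSidedIdeal.IsPrimeIdeal.eq_bot_or_exists_isFiberFactor
    (hδx : δ (MvPolynomial.X 0) = MvPolynomial.pderiv 1 a)
    (hδy : δ (MvPolynomial.X 1) = -MvPolynomial.pderiv 0 a)
    {P : TwoSidedIdeal (OreExtension δ)} (hP : P.IsPrimeIdeal) {b : PolyXY}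
    (hb : δ b ∉ OreExtension.contraction δ P) :
    P = ⊥ ∨ ∃ u, IsFiberFactor a u ∧
      (P : Set (OreExtension δ)) = rightIdealSpan {OreExtension.ι δ u} := by
  have hp := OreExtension.isPrime_contraction hP
  have hst := OreExtension.derivation_mem_contraction P
  have heq := OreExtension.eq_coeffIdeal_contraction hb
  by_cases hp0 : OreExtension.contraction δ P = ⊥
  · left
    rw [heq, ← OreExtension.coeffIdeal_bot]
    congr
  · obtain ⟨u, hu, hpu⟩ := exists_isFiberFactor_of_stable hδx hδy hst hp0 hb
    refine Or.inr ⟨u, hu, ?_⟩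
    rw [heq, OreExtension.coe_coeffIdeal, hpu, OreExtension.rightIdealSpan_ι_span_singleton]

lemma TwoSidedIdeal.isPrimeIdeal_bot_oreExtension :
    (⊥ : TwoSidedIdeal (OreExtension δ)).IsPrimeIdeal := by
  rw [← OreExtension.coeffIdeal_bot]
  exact OreExtension.isPrimeIdeal_coeffIdeal ⊥ _

/-! ### Height one -/

lemma eq_C_of_forall_pderiv_eq_zero {σ k : Type*} [Field k] [CharZero k] {f : MvPolynomial σ k}
    (h : ∀ i, MvPolynomial.pderiv i f = 0) : f = MvPolynomial.C (MvPolynomial.coeff 0 f) := by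
  classical
  ext m
  rw [MvPolynomial.coeff_C]
  split_ifs with hm
  · rw [hm]
  · obtain ⟨i, hi⟩ := Finsupp.ne_iff.1 (Ne.symm hm)
    have hle : Finsupp.single i 1 ≤ m := Finsupp.single_le_iff.2 (Nat.one_le_iff_ne_zero.2 hi)
    have hc := MvPolynomial.coeff_pderiv (i := i) f (m - Finsupp.single i 1)
    rw [h, MvPolynomial.coeff_zero, tsub_add_cancel_of_le hle] at hc
    exact (mul_eq_zero.1 hc.symm).resolve_right (Nat.cast_add_one_ne_zero _)

/-- If `δ = 0` then `a` is constant, and every nonzero `a - c` is a unit. -/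
lemma exists_derivation_ne_zero (hδx : δ (MvPolynomial.X 0) = MvPolynomial.pderiv 1 a)
    (hδy : δ (MvPolynomial.X 1) = -MvPolynomial.pderiv 0 a) {u : PolyXY}
    (hu : IsFiberFactor a u) : ∃ b, δ b ≠ 0 := by
  by_contra! h
  have hpd : ∀ i, MvPolynomial.pderiv i a = 0 := fun i => by
    fin_cases i
    · simpa [hδy] using h (MvPolynomial.X 1)
    · simpa [hδx] using h (MvPolynomial.X 0)
  obtain ⟨c, hne, hnu, -, -⟩ := hu
  have ha := eq_C_of_forall_pderiv_eq_zero hpd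
  rw [ha, ← MvPolynomial.C_sub] at hne hnu
  exact hnu ((isUnit_iff_ne_zero.2 fun h0 => hne (by rw [h0, MvPolynomial.C_0])).map
    MvPolynomial.C)

lemma height_coeffIdeal_span (hδx : δ (MvPolynomial.X 0) = MvPolynomial.pderiv 1 a)
    (hδy : δ (MvPolynomial.X 1) = -MvPolynomial.pderiv 0 a) {u : PolyXY}
    (hu : IsFiberFactor a u) {hst : ∀ b ∈ Ideal.span {u}, δ b ∈ Ideal.span {u}}
    (hP : (OreExtension.coeffIdeal δ (Ideal.span {u}) hst).IsPrimeIdeal) : hP.height = 1 := by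
  have := hu.isPrime_span
  obtain ⟨b, hb⟩ := exists_derivation_ne_zero hδx hδy hu
  obtain ⟨-, -, -, hirr, -⟩ := hu
  let bot : {Q : TwoSidedIdeal (OreExtension δ) // Q.IsPrimeIdeal} :=
    ⟨⊥, TwoSidedIdeal.isPrimeIdeal_bot_oreExtension⟩
  have hbot : ∀ Q : {Q : TwoSidedIdeal (OreExtension δ) // Q.IsPrimeIdeal}, bot ≤ Q :=
    fun Q => (bot_le : ⊥ ≤ Q.1)
  have hlt : bot < ⟨_, hP⟩ := lt_of_le_not_ge (hbot _) fun h => by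
    have h1 : OreExtension.ι δ u ∈ (⊥ : TwoSidedIdeal (OreExtension δ)) :=
      h (OreExtension.ι_mem_coeffIdeal (hI := hst).2 (Ideal.mem_span_singleton_self u))
    rw [← OreExtension.coeffIdeal_bot, OreExtension.ι_mem_coeffIdeal] at h1
    exact hirr.ne_zero h1
  have key : ∀ Q : {Q : TwoSidedIdeal (OreExtension δ) // Q.IsPrimeIdeal},
      Q < ⟨_, hP⟩ → Q = bot := by
    rintro ⟨Q, hQ⟩ hQlt
    have hpr := OreExtension.isPrime_contraction hQ
    have hle : OreExtension.contraction δ Q ≤ Ideal.span {u} := fun c hc =>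
      (OreExtension.ι_mem_coeffIdeal (hI := hst)).1 (hQlt.le hc)
    by_cases h0 : OreExtension.contraction δ Q = ⊥
    · have hb' : δ b ∉ OreExtension.contraction δ Q := by rwa [h0]
      refine Subtype.ext ((OreExtension.eq_coeffIdeal_contraction hb').trans ?_)
      change _ = ⊥
      rw [← OreExtension.coeffIdeal_bot]
      congr
    · refine absurd ?_ hQlt.not_ge
      -- A nonzero prime of a factorial ring contains a prime element; lying in `(u)`, it is
      -- associated to `u`, so `Q` contains `uR`.
      obtain ⟨v, hv, hvp⟩ := hpr.exists_mem_prime_of_ne_bot h0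
      obtain ⟨c, rfl⟩ := Ideal.mem_span_singleton'.1 (hle hv)
      have hdvd := hirr.dvd_symm hvp.irreducible (Dvd.intro_left c rfl)
      refine (OreExtension.coeffIdeal_le_iff (hI := hst)).2 fun d hd => ?_
      exact Ideal.mem_of_dvd _ (hdvd.trans (Ideal.mem_span_singleton.1 hd)) hv
  refine le_antisymm ?_ (Order.one_le_iff_ne_zero.2 (Order.height_ne_zero.2 fun h =>
    hlt.not_ge (h hlt.le)))
  rw [TwoSidedIdeal.IsPrimeIdeal.height, ← Nat.cast_one, Order.height_le_coe_iff]
  intro Q hQ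
  rw [key Q hQ, Order.height_eq_zero.2 fun Q _ => hbot Q]
  exact zero_lt_one

end Hamiltonian

theorem mainTheorem8 (a : PolyXY) (ha : a ≠ 0)
    (δ : Derivation ℂ PolyXY PolyXY)
    (hδx : δ (MvPolynomial.X 0) = MvPolynomial.pderiv 1 a)
    (hδy : δ (MvPolynomial.X 1) = -MvPolynomial.pderiv 0 a) :
    -- (i) `JR` is a two-sided ideal `K` of `R = A[z; δ]`, and `R / JR ≅ (A / J)[z]`
    -- through the map `∑ aᵢ zⁱ + JR ↦ ∑ (aᵢ + J) zⁱ`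
    ∃ K : TwoSidedIdeal (OreExtension δ),
      (K : Set (OreExtension δ)) =
        rightIdealSpan (OreExtension.ι δ '' (gradIdeal a : Set PolyXY)) ∧
      ∃ φ : K.ringCon.Quotient ≃ₐ[ℂ] Polynomial (PolyXY ⧸ gradIdeal a),
        (∀ p : Polynomial PolyXY,
          φ (K.ringCon.mk' (p.sum fun i b => OreExtension.ι δ b * OreExtension.z δ ^ i)) =
            p.map (Ideal.Quotient.mk (gradIdeal a))) ∧
        -- (ii) the prime ideals of `R`
        (∀ P : TwoSidedIdeal (OreExtension δ), P.IsPrimeIdeal ↔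
          P = ⊥ ∨
          (∃ u : PolyXY, IsFiberFactor a u ∧
            (P : Set (OreExtension δ)) = rightIdealSpan {OreExtension.ι δ u}) ∨
          (∃ Q : Ideal (Polynomial (PolyXY ⧸ gradIdeal a)), Q.IsPrime ∧
            (P : Set (OreExtension δ)) = {r | φ (K.ringCon.mk' r) ∈ Q})) ∧
        -- each `uR` is a (two-sided) prime ideal of height one
        (∀ u : PolyXY, IsFiberFactor a u →
          ∃ P : TwoSidedIdeal (OreExtension δ),
            (P : Set (OreExtension δ)) = rightIdealSpan {OreExtension.ι δ u} ∧
            ∃ hP : P.IsPrimeIdeal, hP.height = 1) := by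
  have hJ := hamiltonian_mem_gradIdeal hδx hδy
  refine ⟨OreExtension.coeffIdeal δ (gradIdeal a) fun b _ => hJ b,
    OreExtension.coe_coeffIdeal _ _, OreExtension.quotientEquiv _ hJ, fun p => ?_, fun P => ?_,
    fun u hu => ?_⟩
  · rw [← OreExtension.ofPoly_eq_sum]
    rfl
  · simp only [OreExtension.quotientEquiv_mk']
    constructor
    · intro hP
      -- The dichotomy is whether `δ` vanishes modulo the contraction.
      by_cases h : ∀ b, δ b ∈ OreExtension.contraction δ P
      · refine Or.inr (Or.inr (hP.exists_eq_comap (S := (PolyXY ⧸ gradIdeal a)[X])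
          (OreExtension.reduce δ _ hJ).toRingHom (OreExtension.reduce_surjective _ hJ) fun r hr => ?_))
        exact OreExtension.coeffIdeal_le_iff.2 (gradIdeal_le hδx hδy h)
          ((OreExtension.reduce_eq_zero_iff _ hJ r).1 hr)
      · obtain ⟨b, hb⟩ := not_forall.1 h
        exact (hP.eq_bot_or_exists_isFiberFactor hδx hδy hb).imp_right Or.inl
    · rintro (rfl | ⟨u, hu, hPu⟩ | ⟨Q, hQ, hPQ⟩)
      · exact TwoSidedIdeal.isPrimeIdeal_bot_oreExtension
      · have := hu.isPrime_span
        have hst := hu.derivation_mem_span (hamiltonian_self hδx hδy)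
        have : P = OreExtension.coeffIdeal δ (Ideal.span {u}) hst := SetLike.coe_injective (by
          rw [hPu, OreExtension.coe_coeffIdeal, OreExtension.rightIdealSpan_ι_span_singleton])
        rw [this]
        exact OreExtension.isPrimeIdeal_coeffIdeal _ hst
      · exact TwoSidedIdeal.isPrimeIdeal_of_coe_eq_preimage (S := (PolyXY ⧸ gradIdeal a)[X])
          (OreExtension.reduce δ _ hJ).toRingHom hQ hPQ
  · have := hu.isPrime_span
    have hst := hu.derivation_mem_span (hamiltonian_self hδx hδy)
    refine ⟨OreExtension.coeffIdeal δ (Ideal.span {u}) hst, ?_,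
      OreExtension.isPrimeIdeal_coeffIdeal _ hst, height_coeffIdeal_span hδx hδy hu _⟩
    rw [OreExtension.coe_coeffIdeal, OreExtension.rightIdealSpan_ι_span_singleton]
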